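/- Let $N$ be a finite set of $n$ agents, each owning one house $\omega_i$, partitioned into $k\ge 2$ non-empty communities $C_1,\dots,C_k$ of sizes $n_1,\dots,n_k$. The agents' strict preferences $\succ_i$ over all $n$ houses are drawn independently, each uniformly at random from all strict rankings. An allocation is a permutation of the houses; it is a core allocation if there is no coalition $S$ whose members can reallocate the houses they own among themselves so that no member of $S$ is worse off and at least one is strictly better off. Every housing market with finitely many agents and strict preferences has exactly one core allocation. Let $\sigma^*(i,N)$ be the house of agent $i$ in the core allocation of the whole market, and let $\sigma^*(i,C)$ be the house of $i$ in the core allocation of the market formed by the agents of the community of $i$ alone, with the preferences restricted to their houses. With $\mathrm{rk}_i(h)$ the number of houses in the whole market that agent $i$ weakly prefers to $h$, let $\gamma_i=\mathrm{rk}_i(\sigma^*(i,C))-\mathrm{rk}_i(\sigma^*(i,N))$ be the gains from integration of agent $i$, and let $\overline\Gamma_{C_j}=\frac{1}{n\,n_j}\sum_{i\in C_j}\gamma_i$ be the average percentile gains of community $C_j$. Then: 1. $\mathbb E[\gamma_i]>0$ for every agent $i$, and $\mathbb E[\gamma_i]>\mathbb E[\gamma_{i'}]$ whenever the community of $i$ has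 strictly fewer members than the community of $i'$; 2. $\mathbb E[\overline\Gamma_{C_j}]>0$ for every $j$, and $\mathbb E[\overline\Gamma_{C_j}]>\mathbb E[\overline\Gamma_{C_l}]$ whenever $n_j<n_l$. -/

import Mathlib

open MeasureTheory ProbabilityTheory Finset

/-- A strict ordinal preference (a strict total order) over the houses in `A`.
`r.prefers h h'` means that the house `h` is strictly better than the house `h'`. -/
structure StrictPref (A : Type*) where
  prefers : A → A → Prop
  strict : IsStrictTotalOrder A prefers

/-- The weak preference that belongs to a strict one. -/
def StrictPref.weak {A : Type*} (r : StrictPref A) (h h' : A) : Prop :=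
  h = h' ∨ r.prefers h h'

/-- Restriction of a preference to the houses in `S`. -/
def StrictPref.restrict {A : Type*} (r : StrictPref A) (S : Finset A) : StrictPref S where
  prefers h h' := r.prefers h h'
  strict :=
    haveI := r.strict
    { trichotomous := fun a b h1 h2 =>
        Subtype.ext (Std.Trichotomous.trichotomous (r := r.prefers) a.1 b.1 h1 h2)
      irrefl := fun a => irrefl_of r.prefers a.1
      trans := fun _ _ _ h1 h2 => trans_of r.prefers h1 h2 }

/-- A housing market with set of agents `A`: a profile of strict preferences. The house owned by
agent `a` is identified with `a`, so that the initial endowment is the identity, and an allocation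
is a permutation `x`, where `x a` is (the owner of) the house that agent `a` receives. -/
abbrev HousingMarket (A : Type*) := A → StrictPref A

/-- The sub-market of the agents in `S`, who only trade among themselves. -/
def HousingMarket.restrict {A : Type*} (M : HousingMarket A) (S : Finset A) : HousingMarket S :=
  fun i => (M i).restrict S

/-- The coalition `S` can improve upon `x`: it can reallocate its own houses among its members by
an allocation `y` so that no member is worse off and some member is strictly better off. -/
def HousingMarket.Blocks {A : Type*} (M : HousingMarket A) (S : Set A) (x : Equiv.Perm A) : Prop :=
  ∃ y : Equiv.Perm A, y '' S = S ∧ (∀ i ∈ S, (M i).weak (y i) (x i)) ∧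
    ∃ i ∈ S, (M i).prefers (y i) (x i)

/-- Core allocations: no coalition can improve upon them. -/
def HousingMarket.IsCore {A : Type*} (M : HousingMarket A) (x : Equiv.Perm A) : Prop :=
  ∀ S : Set A, ¬ M.Blocks S x

theorem StrictPref.exists_best {A : Type*} (r : StrictPref A) (R : Finset A) (hR : R.Nonempty) :
    ∃ h ∈ R, ∀ h' ∈ R, r.weak h h' := by
  classical
  have := r.strict
  induction hR using Finset.Nonempty.cons_induction with
  | singleton a => exact ⟨a, by simp, by simp [StrictPref.weak]⟩
  | cons a s ha hs ih =>
    obtain ⟨h, hh, hb⟩ := ih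
    rcases trichotomous_of r.prefers a h with h1 | h1 | h1
    · refine ⟨a, by simp, fun h' hh' => ?_⟩
      rcases Finset.mem_cons.1 hh' with rfl | hh'
      · exact Or.inl rfl
      · rcases hb h' hh' with rfl | h2
        · exact Or.inr h1
        · exact Or.inr (trans_of r.prefers h1 h2)
    · subst h1; exact absurd hh ha
    · refine ⟨h, by simp [hh], fun h' hh' => ?_⟩
      rcases Finset.mem_cons.1 hh' with rfl | hh'
      · exact Or.inr h1
      · exact hb h' hh'

theorem StrictPref.eq_of_weak_of_weak {A : Type*} (r : StrictPref A) {h h' : A}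
    (h1 : r.weak h h') (h2 : r.weak h' h) : h = h' := by
  have := r.strict
  rcases h1 with h1 | h1
  · exact h1
  · rcases h2 with h2 | h2
    · exact h2.symm
    · exact absurd (trans_of r.prefers h1 h2) (irrefl_of r.prefers h)

theorem HousingMarket.core_aux {A : Type*} [Finite A] (M : HousingMarket A) (n : ℕ) :
    ∀ R : Finset A, R.card = n → ∃ x : Equiv.Perm A, (∀ a, a ∉ R → x a = a) ∧
      (∀ S : Set A, S ⊆ R → ¬ M.Blocks S x) ∧
      ∀ z : Equiv.Perm A, (∀ a ∈ R, z a ∈ R) → (∀ S : Set A, S ⊆ R → ¬ M.Blocks S z) →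
        ∀ a ∈ R, z a = x a := by
  classical
  induction n using Nat.strong_induction_on with
  | _ n ih =>
    intro R hn
    rcases R.eq_empty_or_nonempty with rfl | hR
    · refine ⟨1, by simp, ?_, by simp⟩
      rintro S hS ⟨y, -, -, i, hi, -⟩
      simpa using hS hi
    choose t htR htb using fun a => (M a).exists_best R hR
    obtain ⟨a₀, -⟩ := hR
    set T : Set A := Function.periodicPts t with hT
    have hbij : Set.BijOn t T T := Function.bijOn_periodicPts t
    have hTR : T ⊆ R := fun a ha => by
      obtain ⟨b, -, rfl⟩ := hbij.surjOn ha
      exact htR b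
    have hTne : T.Nonempty := by
      obtain ⟨m, k, hmk, h⟩ := Finite.exists_ne_map_eq_of_infinite (fun k : ℕ => t^[k] a₀)
      wlog hlt : m < k generalizing m k
      · exact this k m hmk.symm h.symm (by omega)
      refine ⟨t^[m] a₀, k - m, by omega, ?_⟩
      change t^[k - m] (t^[m] a₀) = t^[m] a₀
      rw [← Function.iterate_add_apply, Nat.sub_add_cancel hlt.le]
      exact h.symm
    set R' : Finset A := R.filter (· ∉ T) with hR'
    have hR'sub : ∀ a, a ∈ R' ↔ a ∈ R ∧ a ∉ T := fun a => by simp [hR']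
    have hcard : R'.card < n := by
      rw [← hn]
      obtain ⟨b, hb⟩ := hTne
      exact Finset.card_lt_card ((Finset.filter_ssubset).2 ⟨b, hTR hb, by simpa using hb⟩)
    obtain ⟨x', hfix, hcore, huniq⟩ := ih _ hcard R' rfl
    have hx'R' : ∀ a ∈ R', x' a ∈ R' := fun a ha => by
      by_contra hcon
      have := x'.injective (hfix _ hcon)
      rw [this] at hcon
      exact hcon ha
    let τ : Equiv.Perm A := Equiv.Perm.ofSubtype (p := fun a => a ∈ T) (hbij.equiv t)
    have hτT : ∀ a ∈ T, τ a = t a := fun a ha => by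
      have := Equiv.Perm.ofSubtype_apply_of_mem (p := fun a => a ∈ T) (hbij.equiv t) ha
      exact this
    have hτ : ∀ a, a ∉ T → τ a = a := fun a ha =>
      Equiv.Perm.ofSubtype_apply_of_not_mem (p := fun a => a ∈ T) (hbij.equiv t) ha
    have hxT : ∀ a ∈ T, (τ * x') a = t a := fun a ha => by
      rw [Equiv.Perm.mul_apply, hfix a (fun h => ((hR'sub a).1 h).2 ha), hτT a ha]
    have hxR' : ∀ a ∈ R', (τ * x') a = x' a := fun a ha => by
      rw [Equiv.Perm.mul_apply, hτ _ ((hR'sub _).1 (hx'R' a ha)).2]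
    -- a permutation that agrees with `t` on part of `S` and maps `S` to `S`
    have key : ∀ (S : Set A) (y : Equiv.Perm A), y '' S = S → (∀ i ∈ S ∩ T, y i = t i) →
        y '' (S \ T) = S \ T := by
      intro S y hyS hyt
      have hmaps : Set.MapsTo y (S ∩ T) (S ∩ T) := fun i hi =>
        ⟨hyS ▸ Set.mem_image_of_mem y hi.1, hyt i hi ▸ hbij.mapsTo hi.2⟩
      have himg : y '' (S ∩ T) = S ∩ T :=
        Set.eq_of_subset_of_ncard_le hmaps.image_subset
          (Set.ncard_image_of_injective _ y.injective).ge (Set.toFinite _)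
      have hST : S \ T = S \ (S ∩ T) := by
        ext a
        simp only [Set.mem_sdiff, Set.mem_inter_iff]
        tauto
      rw [hST, Set.image_sdiff y.injective, hyS, himg]
    refine ⟨τ * x', ?_, ?_, ?_⟩
    · intro a ha
      rw [Equiv.Perm.mul_apply, hfix a (fun h => ha ((hR'sub a).1 h).1),
        hτ a (fun h => ha (hTR h))]
    · rintro S hS ⟨y, hyS, hw, i, hi, hst⟩
      have hyt : ∀ i ∈ S ∩ T, y i = t i := fun i hi => by
        have h1 := hw i hi.1
        rw [hxT i hi.2] at h1
        exact (M i).eq_of_weak_of_weak h1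
          (htb i _ (hS (hyS ▸ Set.mem_image_of_mem y hi.1)))
      have hsub : S \ T ⊆ (R' : Set A) := fun a ha => (hR'sub a).2 ⟨hS ha.1, ha.2⟩
      refine hcore (S \ T) hsub ⟨y, key S y hyS hyt, ?_, i, ?_, ?_⟩
      · intro j hj
        have := hw j hj.1
        rwa [hxR' j (hsub hj)] at this
      · refine ⟨hi, fun hiT => ?_⟩
        rw [hxT i hiT, hyt i ⟨hi, hiT⟩] at hst
        have := (M i).strict
        exact irrefl_of (M i).prefers _ hst
      · have hiT : i ∉ T := fun hiT => by
          rw [hxT i hiT, hyt i ⟨hi, hiT⟩] at hst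
          have := (M i).strict
          exact irrefl_of (M i).prefers _ hst
        rwa [hxR' i (hsub ⟨hi, hiT⟩)] at hst
    · intro z hzR hz
      have hzT : ∀ i ∈ T, z i = t i := by
        intro i hi
        by_contra hne
        refine hz T hTR ⟨τ, ?_, ?_, i, hi, ?_⟩
        · rw [Set.image_congr hτT, hbij.image_eq]
        · intro j hj
          rw [hτT j hj]
          exact htb j _ (hzR j (hTR hj))
        · rw [hτT i hi]
          rcases htb i _ (hzR i (hTR hi)) with h | h
          · exact absurd h.symm hne
          · exact h
      have hzimg : z '' (R : Set A) = R :=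
        Set.eq_of_subset_of_ncard_le (Set.image_subset_iff.2 fun a ha => hzR a ha)
          (Set.ncard_image_of_injective _ z.injective).ge (Set.toFinite _)
      have hzR' : ∀ a ∈ R', z a ∈ R' := by
        intro a ha
        have h := key R z hzimg fun i hi => hzT i hi.2
        have : z a ∈ (R : Set A) \ T := h ▸ Set.mem_image_of_mem z ((hR'sub a).1 ha)
        exact (hR'sub _).2 this
      have hrest := huniq z hzR' fun S hS => hz S fun a ha => ((hR'sub a).1 (hS ha)).1
      intro a ha
      by_cases haT : a ∈ T
      · rw [hzT a haT, hxT a haT]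
      · have haR' := (hR'sub a).2 ⟨ha, haT⟩
        rw [hrest a haR', hxR' a haR']

/-- Every housing market has exactly one core allocation. -/
theorem HousingMarket.existsUnique_isCore {A : Type*} [Finite A] (M : HousingMarket A) :
    ∃! x : Equiv.Perm A, M.IsCore x := by
  classical
  have := Fintype.ofFinite A
  obtain ⟨x, -, hx, hu⟩ := M.core_aux _ Finset.univ rfl
  exact ⟨x, fun S => hx S (by simp), fun z hz =>
    Equiv.ext fun a => hu z (by simp) (fun S _ => hz S) a (Finset.mem_univ a)⟩

/-- The unique core allocation. -/
noncomputable def HousingMarket.core {A : Type*} [Finite A] (M : HousingMarket A) :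
    Equiv.Perm A :=
  M.existsUnique_isCore.choose

theorem HousingMarket.core_isCore {A : Type*} [Finite A] (M : HousingMarket A) :
    M.IsCore M.core :=
  M.existsUnique_isCore.choose_spec.1

section Integration

open scoped Classical in
/-- The rank of house `h` for agent `i`: the number of houses that are at least as good. -/
noncomputable def HousingMarket.rank {N : Type*} [Fintype N] (M : HousingMarket N) (i h : N) : ℕ :=
  #{j | (M i).weak j h}

/-- The house agent `i` receives in the segregated core allocation: the core allocation of the
sub-market formed by the community of `i`. -/
noncomputable def HousingMarket.segregated {N : Type*} [Fintype N] [DecidableEq N]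
    (M : HousingMarket N) (C : Finpartition (univ : Finset N)) (i : N) : N :=
  (M.restrict (C.part i)).core ⟨i, C.mem_part (mem_univ i)⟩

/-- Gains from integration of agent `i` under the core matching scheme. -/
noncomputable def HousingMarket.gain {N : Type*} [Fintype N] [DecidableEq N]
    (M : HousingMarket N) (C : Finpartition (univ : Finset N)) (i : N) : ℝ :=
  (M.rank i (M.segregated C i) : ℝ) - (M.rank i (M.core i) : ℝ)

/-- Average percentile gains from integration for the community `D` (where `D ∈ C.parts`). -/
noncomputable def HousingMarket.avgGain {N : Type*} [Fintype N] [DecidableEq N]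
    (M : HousingMarket N) (C : Finpartition (univ : Finset N)) (D : Finset N) : ℝ :=
  (∑ i ∈ D, M.gain C i) / ((Fintype.card N : ℝ) * (#D : ℝ))

end Integration

/-- The discrete σ-algebra on the (finite) set of strict preferences. -/
instance StrictPref.instMeasurableSpace {A : Type*} : MeasurableSpace (StrictPref A) := ⊤

/-- The random housing market: the preferences of the agents are drawn independently, each
uniformly at random from all strict preferences over the houses. -/
noncomputable def randomMarket (N : Type*) [Fintype N] : Measure (HousingMarket N) :=
  Measure.pi fun _ : N => uniformOn (Set.univ : Set (StrictPref N))

instance StrictPref.instFinite {A : Type*} [Finite A] : Finite (StrictPref A) :=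
  Finite.of_injective (fun r : StrictPref A => r.prefers) fun r s h => by
    cases r; cases s; congr

instance StrictPref.instNonempty {A : Type*} : Nonempty (StrictPref A) :=
  ⟨⟨WellOrderingRel, inferInstance⟩⟩

instance randomMarket.instIsProbabilityMeasure (N : Type*) [Fintype N] :
    IsProbabilityMeasure (randomMarket N) := by
  unfold randomMarket
  infer_instance

/-!
The expected rank of the house that an agent receives in the core of a market of `m` agents, ranked
among all `n` houses, is `(n + 1)` times the average of `1 / 2, 1 / 3, …, 1 / (m + 1)`
(`sum_rank_core`). This average strictly decreases with `m` (`meanInv_lt`), so integration, which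
replaces `m < n` by `n`, is an expected gain for everybody, and the more so the smaller `m` is.

The formula is the expected rank under random serial dictatorship: whoever chooses while `k` of the
`m` houses are left gets the best of `k` random houses, of expected rank `(n + 1) / (k + 1)`
(`sum_rank_bestPrefs`). The core behaves in the same way for the following reason. An allocation
`x` is the core allocation iff there is a potential, constant on the trading cycles of `x`, that
increases from `i` to `j` whenever `i` envies `j` for the house that `j` receives
(`HousingMarket.hasPotential_iff_eq_core`); the potential is read off from the rounds of the top
trading cycles procedure. For uniformly random preferences the houses can be relabelled so that
`x` becomes the initial endowment. Then the envy relation no longer depends on `x`, and the number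
of permutations `x` with a potential for it has to be averaged. For every relation this number
equals the number of linear extensions (`card_hasPotential_eq_card_linearExtension`), that is, the
number of orders of choice under which serial dictatorship gives the agents their own houses. Both
numbers add up when an incomparable pair `a, b` is ordered in its two possible ways. For the
permutations this holds because multiplication by the transposition of `a` and `b` splits or merges
cycles: it exchanges the permutations that allow both orders with those that allow neither.
-/

/-! ### Multiplication by a transposition merges or splits cycles -/

theorem Equiv.Perm.sameCycle_mul_swap {A : Type*} [Fintype A] [DecidableEq A]
    {x : Equiv.Perm A} {a b : A} (hab : a ≠ b) (h : ¬ x.SameCycle a b) :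
    (x * Equiv.swap a b).SameCycle a b := by
  classical
  by_contra hcon
  set y := x * Equiv.swap a b with hy
  -- The indicator of the `y`-cycle of `b` would decrease along the `x`-cycle of `b`, strictly at
  -- `b`.
  let f : A → ℕ := fun i => if y.SameCycle b i then 1 else 0
  have hfy : ∀ i, f (y i) = f i := fun i => by simp [f]
  have hfa : f a = 0 := if_neg fun h' => hcon h'.symm
  have hfb : f b = 1 := if_pos (.refl y b)
  have hya : x b = y a := by simp [hy]
  have hyi : ∀ i, i ≠ a → i ≠ b → x i = y i := fun i h1 h2 => by
    simp [hy, Equiv.swap_apply_of_ne_of_ne h1 h2]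
  let S : Finset A := {i | x.SameCycle b i}
  have hsum : ∑ i ∈ S, f (x i) = ∑ i ∈ S, f i :=
    Finset.sum_equiv x (by simp [S]) (by simp)
  refine (Finset.sum_lt_sum (s := S) (f := fun i => f (x i)) (g := f) ?_ ?_).ne hsum
  · intro i hi
    have hia : i ≠ a := by
      rintro rfl
      exact h (by simpa [S] using hi : x.SameCycle b i).symm
    by_cases hib : i = b
    · subst hib
      simp only [hya, hfy, hfa, hfb]
      omega
    · simp only [hyi i hia hib, hfy, le_refl]
  · exact ⟨b, by simpa [S] using Equiv.Perm.SameCycle.refl x b, by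
      simp only [hya, hfy, hfa, hfb]; omega⟩

theorem Equiv.Perm.SameCycle.not_mul_swap {A : Type*} [Finite A] [DecidableEq A]
    {x : Equiv.Perm A} {a b : A} (hab : a ≠ b) (h : x.SameCycle a b) :
    ¬ (x * Equiv.swap a b).SameCycle a b := by
  classical
  have hex : ∃ k, 0 < k ∧ (x ^ k) a = b := by
    obtain ⟨k, hk, -, hkb⟩ := h.exists_pow_eq''
    exact ⟨k, hk, hkb⟩
  set k := Nat.find hex with hk
  obtain ⟨hk0, hkb⟩ : 0 < k ∧ (x ^ k) a = b := Nat.find_spec hex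
  have hmin : ∀ j, 0 < j → j < k → (x ^ j) a ≠ b := fun j h0 hj hb =>
    Nat.find_min hex hj ⟨h0, hb⟩
  have hnota : ∀ j, 0 < j → j ≤ k → (x ^ j) a ≠ a := by
    intro j h0 hj ha
    rcases hj.lt_or_eq with hj | rfl
    · refine hmin (k - j) (by omega) (by omega) ?_
      have h2 : (x ^ (k - j)) ((x ^ j) a) = b := by
        rw [← Equiv.Perm.mul_apply, ← pow_add, Nat.sub_add_cancel hj.le, hkb]
      rwa [ha] at h2
    · exact hab (ha.symm.trans hkb)
  -- The segment `x a, …, x ^ k a = b` is closed under `x * swap a b` and does not contain `a`.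
  have hinv : ∀ i, (∃ j, 0 < j ∧ j ≤ k ∧ (x ^ j) a = i) →
      ∃ j, 0 < j ∧ j ≤ k ∧ (x ^ j) a = (x * Equiv.swap a b) i := by
    rintro i ⟨j, h0, hj, rfl⟩
    rcases hj.lt_or_eq with hj' | rfl
    · refine ⟨j + 1, by omega, hj', ?_⟩
      rw [Equiv.Perm.mul_apply, Equiv.swap_apply_of_ne_of_ne (hnota j h0 hj) (hmin j h0 hj'),
        pow_succ', Equiv.Perm.mul_apply]
    · exact ⟨1, by omega, by omega, by rw [hkb]; simp⟩
  intro hc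
  obtain ⟨l, -, -, hl⟩ := hc.symm.exists_pow_eq''
  have hall : ∀ l : ℕ, ∃ j, 0 < j ∧ j ≤ k ∧ (x ^ j) a = ((x * Equiv.swap a b) ^ l) b := by
    intro l
    induction l with
    | zero => exact ⟨k, hk0, le_rfl, by simpa using hkb⟩
    | succ l ih =>
      rw [pow_succ', Equiv.Perm.mul_apply]
      exact hinv _ ih
  obtain ⟨j, h0, hj, hja⟩ := hall l
  exact hnota j h0 hj (hja.trans hl)

/-! ### Permutations with a potential and linear extensions -/

/-- `x` has a potential for the relation `E`: a function that is constant on the cycles of `x` and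
strictly increasing along `E`. Equivalently, `E` induces an acyclic relation (without loops) on the
cycles of `x`. -/
def HasPotential {A : Type*} (E : A → A → Prop) (x : Equiv.Perm A) : Prop :=
  ∃ φ : A → ℕ, (∀ i, φ (x i) = φ i) ∧ ∀ i j, E i j → φ i < φ j

/-- The relation `E` with the pair `(a, b)` added. -/
def addPair {A : Type*} (E : A → A → Prop) (a b : A) (i j : A) : Prop :=
  E i j ∨ (i = a ∧ j = b)

section AddPair

variable {A : Type*} {E : A → A → Prop} {x : Equiv.Perm A} {a b : A}

theorem HasPotential.of_addPair (h : HasPotential (addPair E a b) x) : HasPotential E x := by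
  obtain ⟨φ, h1, h2⟩ := h
  exact ⟨φ, h1, fun i j hij => h2 i j (Or.inl hij)⟩

theorem apply_eq_of_sameCycle {φ : A → ℕ} (h : ∀ i, φ (x i) = φ i) (hc : x.SameCycle a b) :
    φ a = φ b := by
  obtain ⟨n, rfl⟩ := hc
  have hinv : ∀ i, φ (x⁻¹ i) = φ i := fun i => by simpa using (h (x⁻¹ i)).symm
  induction n using Int.induction_on with
  | zero => simp
  | succ n ih => rw [add_comm, zpow_add, zpow_one, Equiv.Perm.mul_apply, h, ← ih]
  | pred n ih =>
    rw [sub_eq_add_neg, add_comm, zpow_add, zpow_neg_one, Equiv.Perm.mul_apply, hinv, ← ih]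

theorem apply_mul_swap_eq [DecidableEq A] {φ : A → ℕ} (h : ∀ i, φ (x i) = φ i) (hab : φ a = φ b)
    (i : A) : φ ((x * Equiv.swap a b) i) = φ i := by
  rw [Equiv.Perm.mul_apply, h, Equiv.swap_apply_def]
  split_ifs with h1 h2
  · rw [h1, hab]
  · rw [h2, hab]
  · rfl

/-- A tie between different cycles can be broken by moving one of them up. -/
theorem hasPotential_addPair_of_tie {φ : A → ℕ} (h1 : ∀ i, φ (x i) = φ i)
    (h2 : ∀ i j, E i j → φ i < φ j) (hab : φ a = φ b) (hc : ¬ x.SameCycle a b) :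
    HasPotential (addPair E a b) x := by
  classical
  refine ⟨fun i => 2 * φ i + if x.SameCycle b i then 1 else 0, fun i => by simp [h1], ?_⟩
  rintro i j (hij | ⟨rfl, rfl⟩)
  · have := h2 i j hij
    dsimp only
    split_ifs <;> omega
  · have hji : ¬ x.SameCycle j i := fun h => hc h.symm
    simp only [if_neg hji, if_pos (Equiv.Perm.SameCycle.refl x j), hab]
    omega

theorem HasPotential.not_sameCycle (h : HasPotential (addPair E a b) x) : ¬ x.SameCycle a b := by
  obtain ⟨φ, h1, h2⟩ := h
  exact fun hc => (h2 a b (Or.inr ⟨rfl, rfl⟩)).ne (apply_eq_of_sameCycle h1 hc)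

/-- Potentials `φ` for `(a, b)` and `ψ` for `(b, a)` combine linearly to one that agrees at `a` and
`b`, hence is invariant under the transposition as well. -/
theorem HasPotential.mul_swap_of_addPair [DecidableEq A] (h : HasPotential (addPair E a b) x)
    (h' : HasPotential (addPair E b a) x) : HasPotential E (x * Equiv.swap a b) := by
  obtain ⟨φ, h1, h2⟩ := h
  obtain ⟨ψ, h1', h2'⟩ := h'
  obtain ⟨p, hp⟩ := Nat.exists_eq_add_of_lt (h2 a b (Or.inr ⟨rfl, rfl⟩))
  obtain ⟨q, hq⟩ := Nat.exists_eq_add_of_lt (h2' b a (Or.inr ⟨rfl, rfl⟩))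
  refine ⟨fun i => (q + 1) * φ i + (p + 1) * ψ i,
    apply_mul_swap_eq (φ := fun i => (q + 1) * φ i + (p + 1) * ψ i)
      (fun i => by rw [h1, h1']) (by rw [hp, hq]; ring), fun i j hij => ?_⟩
  have e1 := Nat.mul_lt_mul_of_pos_left (h2 i j (Or.inl hij)) (Nat.succ_pos q)
  have e2 := Nat.mul_lt_mul_of_pos_left (h2' i j (Or.inl hij)) (Nat.succ_pos p)
  exact Nat.add_lt_add e1 e2

/-- If `a` and `b` lie on different cycles, one of the two pairs can be added. -/
theorem HasPotential.addPair_of_not_sameCycle (h : HasPotential E x) (hc : ¬ x.SameCycle a b) :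
    HasPotential (addPair E a b) x ∨ HasPotential (addPair E b a) x := by
  obtain ⟨φ, h1, h2⟩ := h
  rcases lt_trichotomy (φ a) (φ b) with hlt | heq | hlt
  · refine Or.inl ⟨φ, h1, ?_⟩
    rintro i j (hij | ⟨rfl, rfl⟩)
    exacts [h2 i j hij, hlt]
  · exact Or.inl (hasPotential_addPair_of_tie h1 h2 heq hc)
  · refine Or.inr ⟨φ, h1, ?_⟩
    rintro i j (hij | ⟨rfl, rfl⟩)
    exacts [h2 i j hij, hlt]

/-- The permutations for which both pairs can be added correspond, under multiplication by the
transposition of `a` and `b`, to those for which `E` has a potential but neither pair can be added. -/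
theorem hasPotential_addPair_and_iff [Fintype A] [DecidableEq A] (hab : a ≠ b) :
    (HasPotential (addPair E a b) x ∧ HasPotential (addPair E b a) x) ↔
      HasPotential E (x * Equiv.swap a b) ∧
        ¬ (HasPotential (addPair E a b) (x * Equiv.swap a b) ∨
          HasPotential (addPair E b a) (x * Equiv.swap a b)) := by
  constructor
  · rintro ⟨h, h'⟩
    have hc := Equiv.Perm.sameCycle_mul_swap hab h.not_sameCycle
    exact ⟨h.mul_swap_of_addPair h',
      not_or.2 ⟨fun hh => hh.not_sameCycle hc, fun hh => hh.not_sameCycle hc.symm⟩⟩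
  · rintro ⟨h, hn⟩
    have hc : (x * Equiv.swap a b).SameCycle a b := by
      by_contra hc
      exact hn (h.addPair_of_not_sameCycle hc)
    have hc' := hc.not_mul_swap hab
    obtain ⟨φ, h1, h2⟩ := h
    have heq := apply_eq_of_sameCycle h1 hc
    have h1' := apply_mul_swap_eq h1 heq
    rw [mul_assoc, Equiv.swap_mul_self, mul_one] at hc' h1'
    exact ⟨hasPotential_addPair_of_tie h1' h2 heq hc',
      hasPotential_addPair_of_tie h1' h2 heq.symm fun h' => hc' h'.symm⟩

end AddPair

section Count

variable {A : Type*} [Fintype A]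

open scoped Classical in
theorem card_hasPotential_addPair (E : A → A → Prop) {a b : A} (hab : a ≠ b) :
    #{x : Equiv.Perm A | HasPotential E x} =
      #{x : Equiv.Perm A | HasPotential (addPair E a b) x} +
        #{x : Equiv.Perm A | HasPotential (addPair E b a) x} := by
  set V : Finset (Equiv.Perm A) := {x | HasPotential E x}
  set V₁ : Finset (Equiv.Perm A) := {x | HasPotential (addPair E a b) x}
  set V₂ : Finset (Equiv.Perm A) := {x | HasPotential (addPair E b a) x}
  have hsub : V₁ ∪ V₂ ⊆ V := by
    intro x hx
    simp only [V, V₁, V₂, mem_union, mem_filter_univ] at hx ⊢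
    exact hx.elim (·.of_addPair) (·.of_addPair)
  have hbij : #(V₁ ∩ V₂) = #(V \ (V₁ ∪ V₂)) := by
    refine Finset.card_equiv (Equiv.mulRight (Equiv.swap a b)) fun x => ?_
    simp only [V, V₁, V₂, mem_inter, mem_sdiff, mem_union, mem_filter_univ, Equiv.coe_mulRight]
    exact hasPotential_addPair_and_iff hab
  have h1 := Finset.card_union_add_card_inter V₁ V₂
  have h2 := Finset.card_sdiff_add_card_eq_card hsub
  omega

open scoped Classical in
theorem card_linearExtension_addPair (E : A → A → Prop) {a b : A} (hab : a ≠ b) :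
    #{l : A ≃ Fin (Fintype.card A) | ∀ i j, E i j → l i < l j} =
      #{l : A ≃ Fin (Fintype.card A) | ∀ i j, addPair E a b i j → l i < l j} +
        #{l : A ≃ Fin (Fintype.card A) | ∀ i j, addPair E b a i j → l i < l j} := by
  rw [← Finset.card_union_of_disjoint]
  · congr 1
    ext l
    simp only [mem_union, mem_filter_univ]
    constructor
    · intro h
      rcases lt_or_gt_of_ne (l.injective.ne hab) with hlt | hlt
      · left
        rintro i j (hij | ⟨rfl, rfl⟩)
        exacts [h i j hij, hlt]
      · right
        rintro i j (hij | ⟨rfl, rfl⟩)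
        exacts [h i j hij, hlt]
    · rintro (h | h) i j hij
      exacts [h i j (Or.inl hij), h i j (Or.inl hij)]
  · rw [Finset.disjoint_left]
    intro l h1 h2
    simp only [mem_filter_univ] at h1 h2
    exact lt_asymm (h1 a b (Or.inr ⟨rfl, rfl⟩)) (h2 b a (Or.inr ⟨rfl, rfl⟩))

open scoped Classical in
/-- A relation that compares any two elements has at most one linear extension, and no
permutation but the identity has a potential; both exist iff the relation is acyclic. -/
theorem card_hasPotential_of_total (E : A → A → Prop) (hE : ∀ a b, a ≠ b → E a b ∨ E b a) :
    #{x : Equiv.Perm A | HasPotential E x} =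
      #{l : A ≃ Fin (Fintype.card A) | ∀ i j, E i j → l i < l j} := by
  have hinj : ∀ φ : A → ℕ, (∀ i j, E i j → φ i < φ j) → Function.Injective φ := by
    intro φ h i j hij
    by_contra hne
    rcases hE i j hne with h' | h'
    · exact (h i j h').ne hij
    · exact (h j i h').ne hij.symm
  by_cases hex : ∃ φ : A → ℕ, ∀ i j, E i j → φ i < φ j
  · obtain ⟨φ, hφ⟩ := hex
    have hl : ({x : Equiv.Perm A | HasPotential E x} : Finset _) = {1} := by
      ext x
      simp only [mem_filter_univ, mem_singleton]
      constructor
      · rintro ⟨ψ, h1, h2⟩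
        exact Equiv.ext fun i => hinj ψ h2 (h1 i)
      · rintro rfl
        exact ⟨φ, fun _ => rfl, hφ⟩
    -- The linear extension ranks the elements by the potential.
    have hc : #(univ.image φ) = Fintype.card A :=
      Finset.card_image_of_injective _ (hinj φ hφ)
    let e := (univ.image φ).orderIsoOfFin hc
    let l : A ≃ Fin (Fintype.card A) :=
      (Equiv.ofBijective (fun a => (⟨φ a, by simp⟩ : (univ.image φ : Finset ℕ)))
        ⟨fun a b h => hinj φ hφ (by simpa using h), fun ⟨n, hn⟩ => by simpa using hn⟩).trans
        e.symm.toEquiv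
    have hlE : ∀ i j, E i j → l i < l j := fun i j hij =>
      e.symm.lt_iff_lt.2 (show (⟨φ i, by simp⟩ : (univ.image φ : Finset ℕ)) < ⟨φ j, by simp⟩ from
        hφ i j hij)
    have hr : ({l : A ≃ Fin (Fintype.card A) | ∀ i j, E i j → l i < l j} : Finset _) = {l} := by
      ext l'
      simp only [mem_filter_univ, mem_singleton]
      constructor
      · intro h
        have hmono : StrictMono (l.symm.trans l') := by
          intro p q hpq
          have hne : l.symm p ≠ l.symm q := l.symm.injective.ne hpq.ne
          rcases hE _ _ hne with h' | h'
          · exact h _ _ h'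
          · have := hlE _ _ h'
            simp only [Equiv.apply_symm_apply] at this
            exact absurd hpq this.not_gt
        have h1 : StrictMono.orderIsoOfSurjective _ hmono (l.symm.trans l').surjective =
            OrderIso.refl _ := Subsingleton.elim _ _
        ext a
        have := congrArg (fun f => f (l a)) h1
        simpa using congrArg Fin.val this
      · rintro rfl
        exact hlE
    rw [hl, hr, card_singleton, card_singleton]
  · rw [Finset.card_eq_zero.2, Finset.card_eq_zero.2]
    · refine Finset.filter_eq_empty_iff.2 fun l _ h => hex ⟨fun i => l i, h⟩
    · refine Finset.filter_eq_empty_iff.2 fun x _ ⟨φ, _, h⟩ => hex ⟨φ, h⟩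

open scoped Classical in
/-- The permutations with a potential for `E` are as many as the linear extensions of `E`. Both
counts split in the same way when an incomparable pair is ordered in the two possible ways. -/
theorem card_hasPotential_eq_card_linearExtension (E : A → A → Prop) :
    #{x : Equiv.Perm A | HasPotential E x} =
      #{l : A ≃ Fin (Fintype.card A) | ∀ i j, E i j → l i < l j} := by
  induction hn : #{p : A × A | ¬ E p.1 p.2} using Nat.strong_induction_on generalizing E with
  | _ n ih =>
    by_cases hE : ∀ a b, a ≠ b → E a b ∨ E b a
    · exact card_hasPotential_of_total E hE
    push Not at hE
    obtain ⟨a, b, hab, h1, h2⟩ := hE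
    have hlt : ∀ a b, ¬ E a b → #{p : A × A | ¬ addPair E a b p.1 p.2} < n := by
      intro a b h
      rw [← hn]
      refine Finset.card_lt_card ⟨fun p hp => ?_, fun hsub => ?_⟩
      · simp only [mem_filter_univ] at hp ⊢
        exact fun hp' => hp (Or.inl hp')
      · have := @hsub (a, b) (by simpa using h)
        simp [addPair] at this
    rw [card_hasPotential_addPair E hab, card_linearExtension_addPair E hab,
      ih _ (hlt a b h1) _ rfl, ih _ (hlt b a h2) _ rfl]

end Count

/-! ### The core allocation is the only one with a potential -/

/-- Under the allocation `x`, agent `i` envies agent `j` for the house that `j` receives. -/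
def HousingMarket.Envies {A : Type*} (M : HousingMarket A) (x : Equiv.Perm A) (i j : A) : Prop :=
  (M i).prefers (x j) (x i)

/-- A blocking coalition would increase the sum of the potential over its members, although it only
permutes them. -/
theorem HousingMarket.isCore_of_hasPotential {A : Type*} [Finite A] {M : HousingMarket A}
    {x : Equiv.Perm A} (h : HasPotential (M.Envies x) x) : M.IsCore x := by
  classical
  have := Fintype.ofFinite A
  obtain ⟨φ, h1, h2⟩ := h
  rintro S ⟨y, hyS, hw, i, hi, hst⟩
  have hle : ∀ j ∈ S, (M j).prefers (y j) (x j) → φ j < φ (y j) := fun j _ hlt => by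
    have := h2 j (x.symm (y j)) (by simpa [HousingMarket.Envies] using hlt)
    rwa [← h1 (x.symm (y j)), Equiv.apply_symm_apply] at this
  have hmem : ∀ j, j ∈ S ↔ y j ∈ S := fun j => by
    conv_rhs => rw [← hyS]
    simp
  have hsum : ∑ j ∈ S.toFinset, φ (y j) = ∑ j ∈ S.toFinset, φ j :=
    Finset.sum_equiv y (fun j => by simpa using hmem j) (by simp)
  refine (Finset.sum_lt_sum (s := S.toFinset) (f := φ) (g := fun j => φ (y j)) ?_ ?_).ne' hsum
  · intro j hj
    rw [Set.mem_toFinset] at hj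
    rcases hw j hj with heq | hlt
    · exact (by rw [heq, h1] : φ (y j) = φ j).ge
    · exact (hle j hj hlt).le
  · exact ⟨i, by simpa using hi, hle i hi hst⟩

/-- The outcome of the top trading cycles procedure among the agents in `R` has a potential, which
is higher for the agents who leave earlier. -/
theorem HousingMarket.exists_potential_aux {A : Type*} [Fintype A] (M : HousingMarket A) (n : ℕ) :
    ∀ R : Finset A, #R = n → ∃ (x : Equiv.Perm A) (φ : A → ℕ), (∀ a, a ∉ R → x a = a) ∧
      (∀ i, φ (x i) = φ i) ∧ ∀ i ∈ R, ∀ j ∈ R, M.Envies x i j → φ i < φ j := by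
  classical
  induction n using Nat.strong_induction_on with
  | _ n ih =>
    intro R hn
    rcases R.eq_empty_or_nonempty with rfl | hR
    · exact ⟨1, 0, by simp, by simp, by simp⟩
    choose t htR htb using fun a => (M a).exists_best R hR
    obtain ⟨a₀, -⟩ := hR
    set T : Set A := Function.periodicPts t with hT
    have hbij : Set.BijOn t T T := Function.bijOn_periodicPts t
    have hTR : T ⊆ R := fun a ha => by
      obtain ⟨b, -, rfl⟩ := hbij.surjOn ha
      exact htR b
    have hTne : T.Nonempty := by
      obtain ⟨m, k, hmk, h⟩ := Finite.exists_ne_map_eq_of_infinite (fun k : ℕ => t^[k] a₀)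
      wlog hlt : m < k generalizing m k
      · exact this k m hmk.symm h.symm (by omega)
      refine ⟨t^[m] a₀, k - m, by omega, ?_⟩
      change t^[k - m] (t^[m] a₀) = t^[m] a₀
      rw [← Function.iterate_add_apply, Nat.sub_add_cancel hlt.le]
      exact h.symm
    have hcard : #(R.filter (· ∉ T)) < n := by
      rw [← hn]
      obtain ⟨b, hb⟩ := hTne
      exact Finset.card_lt_card ((Finset.filter_ssubset).2 ⟨b, hTR hb, by simpa using hb⟩)
    obtain ⟨x, φ, hfix, hφ, hE⟩ := ih _ hcard _ rfl
    simp only [mem_filter] at hfix hE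
    have hxT : ∀ a ∈ T, x a = a := fun a ha => hfix a (by simp [ha])
    have hxT' : ∀ a, a ∉ T → x a ∉ T := fun a ha h => by
      rw [← x.injective (hxT _ h)] at ha
      exact ha h
    have hxR : ∀ a ∈ R, x a ∈ R := fun a ha => by
      by_contra h
      rw [x.injective (hfix (x a) (by simp [h]))] at h
      exact h ha
    let τ : Equiv.Perm A := Equiv.Perm.ofSubtype (p := fun a => a ∈ T) (hbij.equiv t)
    have hτT : ∀ a ∈ T, τ a = t a := fun a ha =>
      Equiv.Perm.ofSubtype_apply_of_mem (p := fun a => a ∈ T) (hbij.equiv t) ha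
    have hτ : ∀ a, a ∉ T → τ a = a := fun a ha =>
      Equiv.Perm.ofSubtype_apply_of_not_mem (p := fun a => a ∈ T) (hbij.equiv t) ha
    have hyT : ∀ a ∈ T, (τ * x) a = t a := fun a ha => by
      rw [Equiv.Perm.mul_apply, hxT a ha, hτT a ha]
    have hy : ∀ a, a ∉ T → (τ * x) a = x a := fun a ha => by
      rw [Equiv.Perm.mul_apply, hτ _ (hxT' a ha)]
    refine ⟨τ * x, fun a => if a ∈ T then ∑ b, φ b + 1 else φ a, ?_, ?_, ?_⟩
    · intro a ha
      rw [hy a fun h => ha (hTR h), hfix a (by simp [ha])]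
    · intro a
      by_cases ha : a ∈ T
      · simp [hyT a ha, ha, hbij.mapsTo ha]
      · simp [hy a ha, ha, hxT' a ha, hφ]
    · intro i hi j hj hij
      have hiT : i ∉ T := by
        intro hiT
        have hjR : (τ * x) j ∈ R := by
          by_cases hjT : j ∈ T
          · rw [hyT j hjT]; exact htR j
          · rw [hy j hjT]; exact hxR j hj
        have hst := (M i).strict
        rw [HousingMarket.Envies, hyT i hiT] at hij
        rcases htb i _ hjR with h | h
        · rw [← h] at hij
          exact irrefl_of _ _ hij
        · exact irrefl_of _ _ (trans_of _ h hij)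
      by_cases hjT : j ∈ T
      · simp only [hiT, hjT, if_true, if_false]
        exact Nat.lt_succ_of_le (Finset.single_le_sum (fun _ _ => Nat.zero_le _) (mem_univ i))
      · simp only [hiT, hjT, if_false]
        refine hE i ⟨hi, hiT⟩ j ⟨hj, hjT⟩ ?_
        rwa [HousingMarket.Envies, hy i hiT, hy j hjT] at hij

theorem HousingMarket.hasPotential_iff_eq_core {A : Type*} [Finite A] (M : HousingMarket A)
    (x : Equiv.Perm A) : HasPotential (M.Envies x) x ↔ x = M.core := by
  have := Fintype.ofFinite A
  have hcore : ∀ x, HasPotential (M.Envies x) x → x = M.core := fun x h =>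
    M.existsUnique_isCore.unique (isCore_of_hasPotential h) M.core_isCore
  refine ⟨hcore x, ?_⟩
  rintro rfl
  obtain ⟨x, φ, -, h1, h2⟩ := M.exists_potential_aux _ univ rfl
  have hx : HasPotential (M.Envies x) x := ⟨φ, h1, fun i j => h2 i (mem_univ i) j (mem_univ j)⟩
  rwa [← hcore x hx]

/-! ### Uniformly random strict preferences -/

noncomputable instance StrictPref.instFintype {A : Type*} [Finite A] : Fintype (StrictPref A) :=
  Fintype.ofFinite _

/-- The pull-back of a preference along an injective map. -/
def StrictPref.comap {A B : Type*} (r : StrictPref B) (e : A → B) (he : Function.Injective e) :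
    StrictPref A where
  prefers h h' := r.prefers (e h) (e h')
  strict :=
    haveI := r.strict
    { trichotomous := fun _ _ h1 h2 =>
        he (Std.Trichotomous.trichotomous (r := r.prefers) _ _ h1 h2)
      irrefl := fun a => irrefl_of r.prefers (e a)
      trans := fun _ _ _ h1 h2 => trans_of r.prefers h1 h2 }

/-- Relabelling the houses, as a permutation of the preferences. -/
def StrictPref.relabel {A : Type*} (σ : Equiv.Perm A) : Equiv.Perm (StrictPref A) where
  toFun r := r.comap σ σ.injective
  invFun r := r.comap σ.symm σ.symm.injective
  left_inv r := by cases r; simp [StrictPref.comap]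
  right_inv r := by cases r; simp [StrictPref.comap]

theorem StrictPref.relabel_weak {A : Type*} (σ : Equiv.Perm A) (r : StrictPref A) (h h' : A) :
    (StrictPref.relabel σ r).weak h h' ↔ r.weak (σ h) (σ h') := by
  simp [StrictPref.weak, StrictPref.relabel, StrictPref.comap]

theorem StrictPref.weak_or_prefers {A : Type*} (r : StrictPref A) (h h' : A) :
    r.weak h h' ∨ r.prefers h' h := by
  have := r.strict
  rcases trichotomous_of r.prefers h h' with h1 | h1 | h1
  exacts [Or.inl (Or.inr h1), Or.inl (Or.inl h1), Or.inr h1]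

theorem StrictPref.not_prefers_of_weak {A : Type*} (r : StrictPref A) {h h' : A}
    (hw : r.weak h h') : ¬ r.prefers h' h := by
  have := r.strict
  intro hp
  obtain rfl := r.eq_of_weak_of_weak hw (Or.inr hp)
  exact irrefl_of _ _ hp

section Counting

variable {N : Type*} [Fintype N] [DecidableEq N]

open scoped Classical in
/-- The preferences for which `a` is the best house in `T`. -/
noncomputable def bestPrefs (a : N) (T : Finset N) : Finset (StrictPref N) :=
  {r | ∀ h ∈ T, r.weak a h}

theorem mem_bestPrefs {a : N} {T : Finset N} {r : StrictPref N} :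
    r ∈ bestPrefs a T ↔ ∀ h ∈ T, r.weak a h := by
  simp [bestPrefs]

theorem card_bestPrefs_eq {a b : N} {T : Finset N} (ha : a ∈ T) (hb : b ∈ T) :
    #(bestPrefs a T) = #(bestPrefs b T) := by
  classical
  have hT : ∀ h ∈ T, Equiv.swap a b h ∈ T := fun h hh => by
    rw [Equiv.swap_apply_def]
    split_ifs <;> assumption
  refine Finset.card_equiv (StrictPref.relabel (Equiv.swap a b)) fun r => ?_
  simp only [mem_bestPrefs, StrictPref.relabel_weak, Equiv.swap_apply_right]
  refine ⟨fun h k hk => h _ (hT k hk), fun h k hk => ?_⟩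
  simpa using h _ (hT k hk)

theorem card_bestPrefs {a : N} {T : Finset N} (ha : a ∈ T) :
    (#(bestPrefs a T) : ℝ) = Fintype.card (StrictPref N) / #T := by
  classical
  have hsum : ∑ b ∈ T, #(bestPrefs b T) = Fintype.card (StrictPref N) := by
    rw [← Finset.card_biUnion, ← Finset.card_univ]
    · congr 1
      refine Finset.eq_univ_of_forall fun r => ?_
      obtain ⟨b, hb, h⟩ := r.exists_best T ⟨a, ha⟩
      exact Finset.mem_biUnion.2 ⟨b, hb, mem_bestPrefs.2 h⟩
    · intro b hb c hc hbc
      refine Finset.disjoint_left.2 fun r h1 h2 => hbc ?_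
      rw [mem_bestPrefs] at h1 h2
      exact r.eq_of_weak_of_weak (h1 c hc) (h2 b hb)
  rw [Finset.sum_congr rfl fun b hb => card_bestPrefs_eq hb ha, Finset.sum_const,
    smul_eq_mul] at hsum
  have hT : (#T : ℝ) ≠ 0 := by exact_mod_cast Finset.card_ne_zero_of_mem ha
  rw [eq_div_iff hT, mul_comm]
  exact_mod_cast hsum

open scoped Classical in
/-- Given that `a` is the best of `k` houses, its expected rank among all `n` houses is
`(n + 1) / (k + 1)`. -/
theorem sum_rank_bestPrefs {a : N} {T : Finset N} (ha : a ∈ T) :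
    ∑ r ∈ bestPrefs a T, (#{j | r.weak j a} : ℝ) =
      Fintype.card (StrictPref N) / #T * ((Fintype.card N + 1) / (#T + 1)) := by
  have hswap : ∑ r ∈ bestPrefs a T, (#{j | r.weak j a} : ℝ) =
      ∑ j, (#{r ∈ bestPrefs a T | r.weak j a} : ℝ) := by
    simp only [Finset.card_filter, Nat.cast_sum]
    exact Finset.sum_comm
  have hT : (#T : ℝ) ≠ 0 := by exact_mod_cast Finset.card_ne_zero_of_mem ha
  have hT' : (#T : ℝ) + 1 ≠ 0 := by positivity
  have hin : ∀ j ∈ T, (#{r ∈ bestPrefs a T | r.weak j a} : ℝ) =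
      if j = a then (Fintype.card (StrictPref N) / #T : ℝ) else 0 := by
    intro j hj
    split_ifs with hja
    · subst hja
      rw [Finset.filter_true_of_mem fun r _ => (Or.inl rfl : r.weak j j), card_bestPrefs ha]
    · rw [Finset.filter_false_of_mem, Finset.card_empty, Nat.cast_zero]
      intro r hr hw
      exact hja (r.eq_of_weak_of_weak hw (mem_bestPrefs.1 hr j hj))
  have hout : ∀ j ∈ Tᶜ, (#{r ∈ bestPrefs a T | r.weak j a} : ℝ) =
      Fintype.card (StrictPref N) / #T - Fintype.card (StrictPref N) / (#T + 1) := by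
    intro j hj
    rw [Finset.mem_compl] at hj
    have hsplit := Finset.card_filter_add_card_filter_not (s := bestPrefs a T)
      (fun r => r.weak j a)
    -- `j` is worse than `a` iff `a` remains the best house when `j` is added to `T`.
    have hnot : {r ∈ bestPrefs a T | ¬ r.weak j a} = bestPrefs a (insert j T) := by
      ext r
      simp only [mem_filter, mem_bestPrefs, Finset.forall_mem_insert]
      constructor
      · rintro ⟨h, hn⟩
        exact ⟨Or.inr ((r.weak_or_prefers j a).resolve_left hn), h⟩
      · rintro ⟨hj', h⟩
        exact ⟨h, fun hw => hj (r.eq_of_weak_of_weak hw hj' ▸ ha)⟩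
    rw [hnot] at hsplit
    have hc := card_bestPrefs (Finset.mem_insert_of_mem (b := j) ha)
    rw [Finset.card_insert_of_notMem hj, Nat.cast_add_one] at hc
    rw [← card_bestPrefs ha, ← hc, ← hsplit]
    push_cast
    ring
  have hcompl : (#Tᶜ : ℝ) = Fintype.card N - #T := by
    rw [Finset.card_compl, Nat.cast_sub (Finset.card_le_univ T)]
  rw [hswap, ← Finset.sum_add_sum_compl T, Finset.sum_congr rfl hin, Finset.sum_congr rfl hout,
    Finset.sum_ite_eq' T a, if_pos ha, Finset.sum_const, nsmul_eq_mul, hcompl]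
  field_simp
  ring

end Counting

/-! ### The expected rank in the core of a sub-market -/

/-- The pull-back of a housing market along an injective map. -/
def HousingMarket.comap {A N : Type*} (M : HousingMarket N) (e : A → N)
    (he : Function.Injective e) : HousingMarket A :=
  fun i => (M (e i)).comap e he

section Sum

variable {A N : Type*} [Fintype A] [Fintype N] [DecidableEq N]

open scoped Classical in
/-- Relabelling the houses by the core allocation `x` turns it into the initial endowment, so that
the core allocations are traded for permutations with a potential for the relation
"`i` envies `j` for the house that `j` owns", and these for linear extensions of that relation. -/
theorem sum_rank_core_eq_sum_linearExtension (e : A → N) (he : Function.Injective e) (i : A) :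
    ∑ M : HousingMarket N, (M.rank (e i) (e ((M.comap e he).core i)) : ℝ) =
      ∑ l : A ≃ Fin (Fintype.card A), ∑ M : HousingMarket N,
        if ∀ j k, (M.comap e he).Envies 1 j k → l j < l k then (M.rank (e i) (e i) : ℝ) else 0 := by
  have hrelabel : ∀ x : Equiv.Perm A, ∑ M : HousingMarket N,
      (if HasPotential ((M.comap e he).Envies x) x then (M.rank (e i) (e (x i)) : ℝ) else 0) =
      ∑ M : HousingMarket N,
        if HasPotential ((M.comap e he).Envies 1) x then (M.rank (e i) (e i) : ℝ) else 0 := by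
    intro x
    set σ : Equiv.Perm N := x.extendDomain (Equiv.ofInjective e he)
    have hσ : ∀ j, σ (e j) = e (x j) := fun j =>
      Equiv.Perm.extendDomain_apply_image x (Equiv.ofInjective e he) j
    refine Fintype.sum_equiv (Equiv.piCongrRight fun _ => StrictPref.relabel σ) _ _
      fun (M : HousingMarket N) => ?_
    set M' : HousingMarket N := Equiv.piCongrRight (fun _ => StrictPref.relabel σ) M
    have hE : (M'.comap e he).Envies 1 = (M.comap e he).Envies x := by
      ext j k
      change (M (e j)).prefers (σ (e k)) (σ (e j)) ↔ (M (e j)).prefers (e (x k)) (e (x j))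
      rw [hσ, hσ]
    have hR : M'.rank (e i) (e i) = M.rank (e i) (e (x i)) := by
      refine Finset.card_equiv σ fun j => ?_
      simp only [mem_filter_univ, ← hσ]
      exact StrictPref.relabel_weak σ _ _ _
    rw [hE, hR]
  calc ∑ M : HousingMarket N, (M.rank (e i) (e ((M.comap e he).core i)) : ℝ)
      = ∑ M : HousingMarket N, ∑ x : Equiv.Perm A,
          if HasPotential ((M.comap e he).Envies x) x then (M.rank (e i) (e (x i)) : ℝ) else 0 := by
        simp only [HousingMarket.hasPotential_iff_eq_core, Finset.sum_ite_eq', mem_univ, if_true]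
    _ = ∑ M : HousingMarket N, ∑ x : Equiv.Perm A,
          if HasPotential ((M.comap e he).Envies 1) x then (M.rank (e i) (e i) : ℝ) else 0 := by
        rw [Finset.sum_comm, Finset.sum_congr rfl fun x _ => hrelabel x, Finset.sum_comm]
    _ = _ := by
        rw [Finset.sum_comm (s := univ (α := A ≃ Fin (Fintype.card A)))]
        refine Finset.sum_congr rfl fun M _ => ?_
        rw [← Finset.sum_filter, ← Finset.sum_filter, Finset.sum_const, Finset.sum_const,
          card_hasPotential_eq_card_linearExtension]

open scoped Classical in
/-- The houses that agent `a` finds on the market if the agents choose in the decreasing order of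
`l`: those of the agents at or below `a` in that order. An agent `a` outside the sub-market finds
only its own house. -/
noncomputable def available (e : A → N) (l : A ≃ Fin (Fintype.card A)) (a : N) : Finset N :=
  insert a ({h | ∃ j k, e j = a ∧ e k = h ∧ l k ≤ l j} : Finset N)

theorem mem_available_self (e : A → N) (l : A ≃ Fin (Fintype.card A)) (a : N) :
    a ∈ available e l a := by
  simp [available]

theorem card_available_of_notMem_range (e : A → N) (l : A ≃ Fin (Fintype.card A)) {a : N}
    (ha : a ∉ Set.range e) : #(available e l a) = 1 := by
  rw [Finset.card_eq_one]
  refine ⟨a, ?_⟩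
  ext h
  simp only [available, mem_insert, mem_filter_univ, mem_singleton, or_iff_left_iff_imp]
  rintro ⟨j, k, hj, -⟩
  exact absurd ⟨j, hj⟩ ha

theorem card_available {e : A → N} (he : Function.Injective e) (l : A ≃ Fin (Fintype.card A))
    (j : A) : #(available e l (e j)) = l j + 1 := by
  classical
  have h : available e l (e j) = ((Finset.Iic (l j)).map l.symm.toEmbedding).image e := by
    ext h
    simp only [available, mem_insert, mem_filter_univ, mem_image, mem_map_equiv,
      Equiv.symm_symm, mem_Iic]
    constructor
    · rintro (rfl | ⟨j', k, hj, rfl, hk⟩)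
      · exact ⟨j, le_rfl, rfl⟩
      · exact ⟨k, he hj ▸ hk, rfl⟩
    · rintro ⟨k, hk, rfl⟩
      exact Or.inr ⟨j, k, rfl, rfl, hk⟩
  rw [h, Finset.card_image_of_injective _ he, Finset.card_map, Fin.card_Iic]

/-- An order extends the envy relation of the initial endowment iff choosing in that order leaves
every agent with the own house. -/
theorem linearExtension_iff_mem_bestPrefs {e : A → N} (he : Function.Injective e)
    (l : A ≃ Fin (Fintype.card A)) (M : HousingMarket N) :
    (∀ j k, (M.comap e he).Envies 1 j k → l j < l k) ↔
      ∀ a, M a ∈ bestPrefs a (available e l a) := by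
  simp only [mem_bestPrefs, available, Finset.forall_mem_insert, mem_filter_univ]
  constructor
  · refine fun h a => ⟨Or.inl rfl, ?_⟩
    rintro _ ⟨j, k, rfl, rfl, hle⟩
    exact ((M (e j)).weak_or_prefers _ _).resolve_right fun hp => (h j k hp).not_ge hle
  · intro h j k hjk
    by_contra hlt
    exact (M (e j)).not_prefers_of_weak ((h (e j)).2 (e k) ⟨j, k, rfl, rfl, not_lt.1 hlt⟩) hjk

open scoped Classical in
theorem sum_rank_linearExtension (e : A → N) (he : Function.Injective e) (i : A)
    (l : A ≃ Fin (Fintype.card A)) :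
    (∑ M : HousingMarket N,
      if ∀ j k, (M.comap e he).Envies 1 j k → l j < l k then (M.rank (e i) (e i) : ℝ) else 0) =
      Fintype.card (HousingMarket N) / (Fintype.card A).factorial *
        ((Fintype.card N + 1) / ((l i : ℕ) + 2)) := by
  -- The summand factors over the agents, whose preferences are independent.
  let g : N → StrictPref N → ℝ := fun a r =>
    if r ∈ bestPrefs a (available e l a) then
      (if a = e i then (#{j | r.weak j a} : ℝ) else 1) else 0
  have hg : ∀ M : HousingMarket N,
      (if ∀ j k, (M.comap e he).Envies 1 j k → l j < l k then (M.rank (e i) (e i) : ℝ) else 0) =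
        ∏ a, g a (M a) := by
    intro M
    simp only [linearExtension_iff_mem_bestPrefs he]
    split_ifs with h
    · simp only [g, h, if_true, Finset.prod_ite_eq', mem_univ]
      rfl
    · push Not at h
      obtain ⟨a, ha⟩ := h
      exact (Finset.prod_eq_zero (mem_univ a) (if_neg ha)).symm
  have hsum : ∀ a, ∑ r, g a r = Fintype.card (StrictPref N) * (1 / #(available e l a)) *
      if a = e i then ((Fintype.card N + 1) / (#(available e l a) + 1) : ℝ) else 1 := by
    intro a
    have ha := mem_available_self e l a
    simp only [g]
    rw [Finset.sum_ite_mem, Finset.univ_inter, mul_one_div]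
    split_ifs
    · exact sum_rank_bestPrefs ha
    · rw [Finset.sum_const, nsmul_eq_mul, card_bestPrefs ha]
  have hprod : ∏ a, (1 / #(available e l a) : ℝ) = 1 / (Fintype.card A).factorial := by
    rw [Finset.prod_div_distrib, Finset.prod_const_one, ← Nat.cast_prod]
    congr 2
    rw [← Fintype.prod_of_injective e he (fun j => (l j : ℕ) + 1) _
      (fun a ha => card_available_of_notMem_range e l ha) (fun j => (card_available he l j).symm),
      l.prod_comp fun k : Fin (Fintype.card A) => (k : ℕ) + 1,
      Fin.prod_univ_eq_prod_range (fun k => k + 1), Finset.prod_range_add_one_eq_factorial]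
  rw [Finset.sum_congr rfl fun M _ => hg M, ← Fintype.prod_sum, Finset.prod_congr rfl
    fun a _ => hsum a, Finset.prod_mul_distrib, Finset.prod_mul_distrib, hprod, Finset.prod_const,
    Finset.prod_ite_eq', if_pos (mem_univ _), card_available he, Fintype.card_pi, Finset.prod_const]
  push_cast
  ring

/-- A uniformly random order puts `i` in each position equally often. -/
theorem sum_equiv_apply (i : A) (f : Fin (Fintype.card A) → ℝ) [DecidableEq A] :
    ∑ l : A ≃ Fin (Fintype.card A), f (l i) =
      (Fintype.card A).factorial * ((∑ k, f k) / Fintype.card A) := by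
  have hsymm : ∀ j, ∑ l : A ≃ Fin (Fintype.card A), f (l j) =
      ∑ l : A ≃ Fin (Fintype.card A), f (l i) := fun j =>
    Fintype.sum_equiv (Equiv.equivCongr (Equiv.swap i j) (Equiv.refl _)) _ _ fun l => by simp
  have htot : ∑ j : A, ∑ l : A ≃ Fin (Fintype.card A), f (l j) =
      (Fintype.card A).factorial * ∑ k, f k := by
    rw [Finset.sum_comm, Finset.sum_congr rfl fun l _ => l.sum_comp f, Finset.sum_const,
      Finset.card_univ, Fintype.card_equiv (Fintype.equivFin A), nsmul_eq_mul]
  rw [Finset.sum_congr rfl fun j _ => hsymm j, Finset.sum_const, Finset.card_univ,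
    nsmul_eq_mul] at htot
  have : Nonempty A := ⟨i⟩
  have hA : (Fintype.card A : ℝ) ≠ 0 := by exact_mod_cast Fintype.card_ne_zero
  rw [← mul_div_assoc, eq_div_iff hA, mul_comm]
  exact htot

/-- The average of `1 / (k + 2)` over `k < m`. -/
noncomputable def meanInv (m : ℕ) : ℝ := (∑ k ∈ range m, 1 / ((k : ℝ) + 2)) / m

/-- The sum over all profiles of the rank, in the whole market `N`, of the house that agent `i`
receives in the core of the sub-market `A`. -/
theorem sum_rank_core (e : A → N) (he : Function.Injective e) (i : A) :
    ∑ M : HousingMarket N, (M.rank (e i) (e ((M.comap e he).core i)) : ℝ) =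
      Fintype.card (HousingMarket N) * ((Fintype.card N + 1) * meanInv (Fintype.card A)) := by
  classical
  rw [sum_rank_core_eq_sum_linearExtension,
    Finset.sum_congr rfl fun l _ => sum_rank_linearExtension e he i l,
    sum_equiv_apply i fun k => (Fintype.card (HousingMarket N) / (Fintype.card A).factorial *
        ((Fintype.card N + 1) / ((k : ℕ) + 2)) : ℝ), meanInv,
    Fin.sum_univ_eq_sum_range fun k : ℕ =>
      (Fintype.card (HousingMarket N) / (Fintype.card A).factorial *
        ((Fintype.card N + 1) / ((k : ℝ) + 2)) : ℝ)]
  have hf : ((Fintype.card A).factorial : ℝ) ≠ 0 := by positivity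
  simp only [div_eq_mul_inv, one_mul, ← Finset.mul_sum, mul_assoc]
  field_simp

end Sum

/-! ### Monotonicity in the size of the sub-market -/

theorem meanInv_succ_lt {m : ℕ} (hm : 1 ≤ m) : meanInv (m + 1) < meanInv m := by
  have hm0 : (0 : ℝ) < m := by exact_mod_cast hm
  -- The new term `1 / (m + 2)` is smaller than each of the old ones.
  have hlow : (m : ℝ) * (1 / (m + 1)) ≤ ∑ k ∈ range m, 1 / ((k : ℝ) + 2) := by
    calc (m : ℝ) * (1 / (m + 1)) = ∑ k ∈ range m, 1 / ((m : ℝ) + 1) := by simp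
      _ ≤ _ := by
        refine Finset.sum_le_sum fun k hk => ?_
        have : (k : ℝ) + 1 ≤ m := by exact_mod_cast Finset.mem_range.1 hk
        exact one_div_le_one_div_of_le (by positivity) (by linarith)
  have hlt : (m : ℝ) * (1 / (m + 2)) < m * (1 / (m + 1)) :=
    mul_lt_mul_of_pos_left (one_div_lt_one_div_of_lt (by positivity) (by linarith)) hm0
  rw [meanInv, meanInv, Finset.sum_range_succ, Nat.cast_add_one,
    div_lt_div_iff₀ (by positivity) hm0]
  linarith

theorem meanInv_lt {m n : ℕ} (hm : 1 ≤ m) (hmn : m < n) : meanInv n < meanInv m := by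
  induction n, hmn using Nat.le_induction with
  | base => exact meanInv_succ_lt hm
  | succ n hn ih => exact (meanInv_succ_lt (hm.trans (Nat.le_of_succ_le hn))).trans ih

/-! ### Expected gains from integration -/

instance StrictPref.instDiscreteMeasurableSpace {A : Type*} :
    DiscreteMeasurableSpace (StrictPref A) := ⟨fun _ => trivial⟩

theorem integral_randomMarket {N : Type*} [Fintype N] [DecidableEq N] (f : HousingMarket N → ℝ) :
    ∫ M, f M ∂(randomMarket N) = (∑ M, f M) / Fintype.card (HousingMarket N) := by
  have huni : randomMarket N = uniformOn (Set.univ : Set (HousingMarket N)) := by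
    rw [randomMarket, ← Set.pi_univ Set.univ, ProbabilityTheory.uniformOn_pi]
  rw [integral_fintype (.of_finite), Finset.sum_div]
  refine Finset.sum_congr rfl fun M _ => ?_
  rw [huni, Measure.real, uniformOn_univ, Measure.count_singleton]
  simp [div_eq_inv_mul]

section Gain

variable {N : Type*} [Fintype N] [DecidableEq N] (C : Finpartition (univ : Finset N))

/-- The expected gain of an agent depends only on the size of its community. -/
theorem integral_gain (i : N) : ∫ M, M.gain C i ∂(randomMarket N) =
    (Fintype.card N + 1) * (meanInv #(C.part i) - meanInv (Fintype.card N)) := by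
  have hseg : ∑ M : HousingMarket N, (M.rank i (M.segregated C i) : ℝ) =
      Fintype.card (HousingMarket N) * ((Fintype.card N + 1) * meanInv #(C.part i)) := by
    have h := sum_rank_core (Subtype.val : C.part i → N) Subtype.val_injective
      ⟨i, C.mem_part (mem_univ i)⟩
    rwa [Fintype.card_coe] at h
  have hcore : ∑ M : HousingMarket N, (M.rank i (M.core i) : ℝ) =
      Fintype.card (HousingMarket N) * ((Fintype.card N + 1) * meanInv (Fintype.card N)) :=
    sum_rank_core (id : N → N) Function.injective_id i
  have hQ : (Fintype.card (HousingMarket N) : ℝ) ≠ 0 := by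
    exact_mod_cast Fintype.card_ne_zero
  simp only [integral_randomMarket, HousingMarket.gain]
  rw [Finset.sum_sub_distrib, hseg, hcore]
  field_simp

theorem integral_avgGain {D : Finset N} (hD : D ∈ C.parts) :
    ∫ M, M.avgGain C D ∂(randomMarket N) =
      (Fintype.card N + 1) / Fintype.card N * (meanInv #D - meanInv (Fintype.card N)) := by
  have hD0 : (#D : ℝ) ≠ 0 := by exact_mod_cast (C.nonempty_of_mem_parts hD).card_ne_zero
  simp only [HousingMarket.avgGain]
  rw [integral_div, integral_finsetSum _ fun _ _ => .of_finite, Finset.sum_congr rfl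
    fun i hi => (integral_gain C i).trans (by rw [C.part_eq_of_mem hD hi]), Finset.sum_const,
    nsmul_eq_mul, mul_comm (#D : ℝ), mul_div_mul_right _ _ hD0, mul_div_right_comm]

theorem card_part_lt_card (hC : 2 ≤ #C.parts) {D : Finset N} (hD : D ∈ C.parts) :
    #D < Fintype.card N := by
  obtain ⟨E, hE, hED⟩ := Finset.exists_mem_ne hC D
  obtain ⟨b, hb⟩ := C.nonempty_of_mem_parts hE
  exact Finset.card_lt_univ_of_notMem fun hbD => hED (C.eq_of_mem_parts hE hD hb hbD)

end Gain

theorem corollary1 {N : Type*} [Fintype N] [DecidableEq N]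
    (C : Finpartition (univ : Finset N)) (hC : 2 ≤ #C.parts) :
    -- expected gains are positive for every agent, and larger for agents of smaller communities
    (∀ i : N, 0 < ∫ M, M.gain C i ∂(randomMarket N)) ∧
    (∀ i j : N, #(C.part i) < #(C.part j) →
      ∫ M, M.gain C j ∂(randomMarket N) < ∫ M, M.gain C i ∂(randomMarket N)) ∧
    -- the same for the average percentile gains of the communities
    (∀ D ∈ C.parts, 0 < ∫ M, M.avgGain C D ∂(randomMarket N)) ∧
    (∀ D ∈ C.parts, ∀ E ∈ C.parts, #D < #E →
      ∫ M, M.avgGain C E ∂(randomMarket N) < ∫ M, M.avgGain C D ∂(randomMarket N)) := by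
  have hpart : ∀ i, C.part i ∈ C.parts := fun i => C.part_mem.2 (mem_univ i)
  have hpos : ∀ D ∈ C.parts, 1 ≤ #D := fun D hD => (C.nonempty_of_mem_parts hD).card_pos
  have hcard : ∀ D ∈ C.parts, (0 : ℝ) < Fintype.card N := fun D hD => by
    exact_mod_cast (Nat.zero_le _).trans_lt (card_part_lt_card C hC hD)
  refine ⟨fun i => ?_, fun i j hij => ?_, fun D hD => ?_, fun D hD E hE hDE => ?_⟩
  · rw [integral_gain]
    have := meanInv_lt (hpos _ (hpart i)) (card_part_lt_card C hC (hpart i))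
    exact mul_pos (by positivity) (sub_pos.2 this)
  · rw [integral_gain, integral_gain]
    have := meanInv_lt (hpos _ (hpart i)) hij
    exact mul_lt_mul_of_pos_left (sub_lt_sub_right this _) (by positivity)
  · rw [integral_avgGain C hD]
    have := meanInv_lt (hpos D hD) (card_part_lt_card C hC hD)
    have := hcard D hD
    exact mul_pos (by positivity) (by linarith)
  · rw [integral_avgGain C hD, integral_avgGain C hE]
    have := meanInv_lt (hpos D hD) hDE
    have := hcard D hD
    exact mul_lt_mul_of_pos_left (by linarith) (by positivity)
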